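/- Let $F$ be an algebraically closed field of characteristic $0$, let $H$ be a finite dimensional associative $F$-algebra with $1$, and let $B_0$ be a finite dimensional associative $F$-algebra (not assumed to be unital) with a generalized $H$-action: $B_0$ is endowed with a unital homomorphism $H \to \mathrm{End}_F(B_0)$ such that for every $h \in H$ there exist finitely many $h'_i, h''_i, h'''_i, h''''_i \in H$ with $$h(ab)=\sum_i\bigl((h'_i a)(h''_i b) + (h'''_i b)(h''''_i a)\bigr) \quad\text{for all } a,b \in B_0.$$ Assume that $B_0$ is semisimple (its Jacobson radical is zero) and $H$-simple ($B_0 \ne 0$, and $0$ and $B_0$ are its only $H$-invariant two-sided ideals). Let $a_1,\ldots,a_\ell$ be a basis of $B_0$. Fix a basis $(\gamma_\beta)_{\beta\in\Lambda}$ of $H$. An $H$-polynomial in a set $X$ of variables is an element of the free associative $F$-algebra $F\langle X|H\rangle$ on the generators $x^{\gamma_\beta}$, $x\in X$, $\beta\in\Lambda$; put $x^h:=\sum_\beta \alpha_\beta x^{\gamma_\beta}$ for $h=\sum_\beta\alpha_\beta\gamma_\beta\in H$. A substitution of elements of $B_0$ for the variables extends uniquely to a homomorphism $F\langle X|H\rangle\to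 B_0$ that maps $x^h$ to $h\bar x$ when $\bar x$ is substituted for $x$. An $H$-polynomial is multilinear in the variables $x_1,\ldots,x_n$ if it is a linear combination of products $x_{\sigma(1)}^{h_1}x_{\sigma(2)}^{h_2}\cdots x_{\sigma(n)}^{h_n}$ with $\sigma\in S_n$, $h_i\in H$; it is alternating in a set of variables if it changes its sign whenever two different variables of this set are interchanged. Then there exist an integer $T \geqslant 0$ and elements $\bar z_1,\ldots,\bar z_T\in B_0$ such that for every integer $k\geqslant 1$ there exists an $H$-polynomial $$f=f(x_1^1, \ldots, x_\ell^1; \ldots; x^{2k}_1, \ldots, x^{2k}_\ell;\ z_1, \ldots, z_T;\ z),$$ multilinear in these $2k\ell+T+1$ variables and alternating in each of the $2k$ disjoint sets $\{x^i_1,\ldots,x^i_\ell\}$, $1\leqslant i\leqslant 2k$, such that for every $\bar z\in B_0$ $$f(a_1, \ldots, a_\ell; \ldots; a_1, \ldots, a_\ell;\ \bar z_1, \ldots, \bar z_T;\ \bar z) = \bar z .$$ -/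

import Mathlib

/-- The Jacobson radical of an associative ring that need not have a unit: the set of all `a` such
that every element of `Ra` is quasi-regular. -/
def jacobsonRadical (R : Type*) [NonUnitalRing R] : Set R :=
  {a | ∀ b : R, IsQuasiregular (b * a)}

/-- An associative algebra (not assumed to be unital) is semisimple if its Jacobson radical is
zero. This is used for finite dimensional algebras only. -/
def IsSemisimpleAlg (R : Type*) [NonUnitalRing R] : Prop :=
  jacobsonRadical R = {0}

section GeneralizedAction

variable {F H A : Type*} [Field F] [Ring H] [Algebra F H] [NonUnitalRing A] [Module F A]

/-- A (unital) homomorphism `ρ : H → End_F(A)` is a generalized `H`-action on the associative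
algebra `A` if for every `h` there are finitely many `h'ᵢ, h''ᵢ, h'''ᵢ, h''''ᵢ` in `H` with
`h(ab) = ∑ᵢ ((h'ᵢ a)(h''ᵢ b) + (h'''ᵢ b)(h''''ᵢ a))` for all `a, b`. -/
def IsGeneralizedAction (ρ : H →ₐ[F] Module.End F A) : Prop :=
  ∀ h : H, ∃ (m : ℕ) (h₁ h₂ h₃ h₄ : Fin m → H), ∀ a b : A,
    ρ h (a * b) = ∑ i, (ρ (h₁ i) a * ρ (h₂ i) b + ρ (h₃ i) b * ρ (h₄ i) a)

/-- A subspace of `A` that is a two-sided ideal invariant under all operators `ρ h`. -/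
def IsInvariantIdeal (ρ : H →ₐ[F] Module.End F A) (I : Submodule F A) : Prop :=
  (∀ a : A, ∀ b ∈ I, a * b ∈ I ∧ b * a ∈ I) ∧ ∀ h : H, ∀ b ∈ I, ρ h b ∈ I

/-- `A` is `H`-simple: it is nonzero and has no invariant two-sided ideals but `0` and `A`. -/
def IsHSimple (ρ : H →ₐ[F] Module.End F A) : Prop :=
  Nontrivial A ∧ ∀ I : Submodule F A, IsInvariantIdeal ρ I → I = ⊥ ∨ I = ⊤

end GeneralizedAction

/-- The product `f 0 * (f 1 * (⋯ * f n))` of a nonempty finite sequence. -/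
def seqProd {M : Type*} [Mul M] : (n : ℕ) → (Fin (n + 1) → M) → M
  | 0, f => f 0
  | n + 1, f => f 0 * seqProd n (fun i => f i.succ)

/-- The free associative algebra (without unit) over `F` on the generators `x_i^{γ_β}`, `i : ι`,
`β : Λ`: it has the nonempty words in the generators as a basis. Here `ι` is the set of variables
and `Λ` is the index set of a basis `γ` of `H`. -/
abbrev HPoly (F ι Λ : Type*) [Field F] : Type _ :=
  MonoidAlgebra F (FreeSemigroup (ι × Λ))

namespace HPoly

noncomputable section

variable {F ι Λ H A : Type*} [Field F] [Ring H] [Algebra F H]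
  [NonUnitalRing A] [Module F A] [IsScalarTower F A A] [SMulCommClass F A A]

/-- The generator `x_i^{γ_β}`. -/
def gen (i : ι) (β : Λ) : HPoly F ι Λ :=
  MonoidAlgebra.single (FreeSemigroup.of (i, β)) 1

/-- The homomorphism of algebras that sends `x_i^{γ_β}` to `g (i, β)`. -/
def lift (g : ι × Λ → A) : HPoly F ι Λ →ₙₐ[F] A :=
  MonoidAlgebra.liftMagma F (FreeSemigroup.lift g)

/-- `x_i^h = ∑_β α_β x_i^{γ_β}` for `h = ∑_β α_β γ_β`. -/
def var (γ : Module.Basis Λ F H) (i : ι) (h : H) : HPoly F ι Λ :=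
  (γ.repr h).sum fun β α => α • gen i β

/-- The value `f(a)` of an `H`-polynomial under the substitution `x_i ↦ a i`, that is, the image of
`f` under the homomorphism with `x_i^h ↦ ρ h (a i)`. -/
def eval (γ : Module.Basis Λ F H) (ρ : H →ₐ[F] Module.End F A) (a : ι → A) :
    HPoly F ι Λ →ₙₐ[F] A :=
  lift fun p => ρ (γ p.2) (a p.1)

/-- Renaming of variables: `x_i^{γ_β} ↦ x_{σ i}^{γ_β}`. -/
def rename (σ : ι → ι) : HPoly F ι Λ →ₙₐ[F] HPoly F ι Λ :=
  lift fun p => gen (σ p.1) p.2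

/-- The space of `H`-polynomials multilinear in all the variables `x_i`, `i : ι` (where `ι` is
finite and nonempty): the span of the products of the `x_i^{h_i}`, each variable
occurring exactly once, in any order, with any exponents `h_i` in `H`. -/
def multilinear (ι : Type*) (γ : Module.Basis Λ F H) : Submodule F (HPoly F ι Λ) :=
  Submodule.span F {f | ∃ (n : ℕ) (e : Fin (n + 1) ≃ ι) (h : Fin (n + 1) → H),
    f = seqProd n fun i => var γ (e i) (h i)}

/-- `f` is alternating in the set of variables `S`: it changes its sign when two different
variables from `S` are interchanged. -/
def IsAlternatingIn [DecidableEq ι] (f : HPoly F ι Λ) (S : Set ι) : Prop :=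
  ∀ i ∈ S, ∀ j ∈ S, i ≠ j → rename (Equiv.swap i j) f = -f

end

end HPoly

/-! In characteristic `0`, semisimplicity makes the trace form `tr(L_b L_c)` nondegenerate. By
`H`-simplicity the action and the multiplications leave no proper nonzero subspace invariant, so by
Burnside's theorem they generate `End(B)`. The proof works with functions on `B` given by
`H`-polynomials with constants, of prescribed degree in each variable and constant, and makes such a
function equal to a product of determinants times `z`.

One block (`exists_det_smul`): a function alternating in a full block is its determinant times a
value. The operators `E` for which `det(x) • E z` is obtained from constants of nonzero trace form a
two-sided ideal of `End(B)`. It is nonzero by an explicit alternating product, so it contains `1`.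
Summing two such functions requires equal constants, which the trace trick provides.

Trace trick (`trace_smul`): applying an operator `u` to each variable of a block in turn and summing
multiplies the determinant by `tr u`. With `u = L_{pq}` this gives the entries of a Gram matrix of
the trace form, whose determinant is a nonzero multiple of `det p * det q`. So pairs of blocks are
added without new constants (`det_smul_det_smul`), and the constants do not depend on `k`.

The generalized action pushes every `h` down to the letters, which turns these functions into formal
multilinear `H`-polynomials. Signed averaging makes them formally alternating without changing the
required value. -/

/-! ### Traces, determinants and irreducible sets of operators -/

section LinearAlgebra

variable {F V : Type*} [Field F] [AddCommGroup V] [Module F V]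

/-- In characteristic zero, an endomorphism all of whose positive powers have trace zero is
nilpotent. -/
theorem Module.End.isNilpotent_of_trace_pow_eq_zero [CharZero F] [FiniteDimensional F V]
    (f : Module.End F V) (hf : ∀ n : ℕ, LinearMap.trace F V (f ^ (n + 1)) = 0) :
    IsNilpotent f := by
  classical
  obtain ⟨q, hq, hXq⟩ := (minpoly F f).exists_eq_pow_rootMultiplicity_mul_and_not_dvd
    (minpoly.ne_zero (Algebra.IsIntegral.isIntegral f)) 0
  set n := (minpoly F f).rootMultiplicity 0
  rw [Polynomial.C_0, sub_zero] at hq hXq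
  have hcop : IsCoprime ((Polynomial.X : Polynomial F) ^ (n + 1)) q :=
    ((Polynomial.irreducible_X.coprime_iff_not_dvd).2 hXq).pow_left
  obtain ⟨u, v, huv⟩ := hcop
  have hzero : Polynomial.aeval f (Polynomial.X ^ (n + 1) * q) = 0 := by
    rw [pow_succ', mul_assoc, ← hq, map_mul, minpoly.aeval, mul_zero]
  -- The projection onto the part where `f` is invertible. The exponent `n + 1` ensures that its
  -- polynomial has no constant term even if `n = 0`, so its trace, which is its rank, vanishes.
  set e : Module.End F V := Polynomial.aeval f (u * Polynomial.X ^ (n + 1)) with he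
  have hidem : IsIdempotentElem e := by
    have h1 : u * Polynomial.X ^ (n + 1) * (u * Polynomial.X ^ (n + 1)) =
        u * Polynomial.X ^ (n + 1) - u * v * (Polynomial.X ^ (n + 1) * q) := by
      linear_combination u * Polynomial.X ^ (n + 1) * huv
    rw [IsIdempotentElem, he, ← map_mul, h1, map_sub, map_mul _ (u * v), hzero, mul_zero, sub_zero]
  have htr : LinearMap.trace F V e = 0 := by
    rw [he, map_mul, Polynomial.aeval_eq_sum_range, Finset.sum_mul, map_sum]
    refine Finset.sum_eq_zero fun i _ => ?_
    rw [map_pow, Polynomial.aeval_X, smul_mul_assoc, ← pow_add, map_smul, ← add_assoc, hf, smul_zero]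
  have hrange : LinearMap.range e = ⊥ := by
    rw [(LinearMap.IsIdempotentElem.isProj_range e hidem).trace, Nat.cast_eq_zero] at htr
    exact Submodule.finrank_eq_zero.1 htr
  have he0 : e = 0 := LinearMap.range_eq_bot.1 hrange
  refine ⟨n + 1, ?_⟩
  have h2 : (Polynomial.X : Polynomial F) ^ (n + 1) =
      Polynomial.X ^ (n + 1) * (u * Polynomial.X ^ (n + 1)) +
        v * (Polynomial.X ^ (n + 1) * q) := by
    linear_combination -Polynomial.X ^ (n + 1) * huv
  have h3 := congrArg (Polynomial.aeval f) h2
  rwa [map_add, map_mul _ v, hzero, mul_zero, map_mul, ← he, he0, mul_zero, add_zero, map_pow,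
    Polynomial.aeval_X] at h3

variable {n : Type*} [Fintype n] [DecidableEq n]

/-- Applying an endomorphism to one argument of the determinant at a time and summing up
multiplies the determinant by the trace. -/
theorem Module.Basis.sum_det_update_eq_trace_mul (a : Module.Basis n F V) (u : Module.End F V)
    (x : n → V) :
    ∑ i, a.det (Function.update x i (u (x i))) = LinearMap.trace F V u * a.det x := by
  have h : ∀ i, a.det (Function.update x i (u (x i))) =
      ((a.toMatrix x).cramer (fun j => a.repr (u (x i)) j)) i := fun i => by
    rw [Matrix.cramer_apply, Module.Basis.det_apply, Module.Basis.toMatrix_update]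
  have hU : a.toMatrix (fun i => u (x i)) = LinearMap.toMatrix a a u * a.toMatrix x := by
    ext i j
    exact (congrFun (LinearMap.toMatrix_mulVec_repr a a u (x j)) i).symm
  -- By Cramer's rule these determinants are the diagonal entries of `adj(X) U X`, whose trace is
  -- that of `U X adj(X) = det(X) U`.
  have h' : ∀ i, a.det (Function.update x i (u (x i))) =
      ((a.toMatrix x).adjugate * a.toMatrix (fun i => u (x i))) i i := fun i => by
    rw [h, Matrix.cramer_eq_adjugate_mulVec]
    rfl
  simp_rw [h']
  change Matrix.trace _ = _
  rw [hU, Matrix.trace_mul_comm, mul_assoc, Matrix.mul_adjugate, Matrix.mul_smul, Matrix.mul_one,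
    Matrix.trace_smul, ← LinearMap.trace_eq_matrix_trace, Module.Basis.det_apply, smul_eq_mul,
    mul_comm]

/-- A vector valued alternating map in `dim V` arguments is a multiple of the determinant. -/
theorem AlternatingMap.eq_det_smul {W : Type*} [AddCommGroup W] [Module F W]
    (a : Module.Basis n F V) (f : V [⋀^n]→ₗ[F] W) (x : n → V) : f x = a.det x • f a := by
  have : f = (LinearMap.toSpanSingleton F W (f a)).compAlternatingMap a.det := by
    refine a.ext_alternating fun v hv => ?_
    obtain ⟨σ, rfl⟩ : ∃ σ : Equiv.Perm n, v = σ :=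
      ⟨Equiv.ofBijective v (Finite.injective_iff_bijective.1 hv), rfl⟩
    have h1 := f.map_perm a σ
    have h2 := a.det.map_perm a σ
    simp only [Function.comp_def] at h1 h2
    simp [h1, h2, a.det_self]
  conv_lhs => rw [this]
  simp

/-- The Gram determinant of two families of vectors with respect to a bilinear form. -/
theorem LinearMap.BilinForm.det_gram (a : Module.Basis n F V) (β : LinearMap.BilinForm F V)
    (p q : n → V) :
    (Matrix.of fun i j => β (p i) (q j)).det =
      a.det p * a.det q * (LinearMap.BilinForm.toMatrix a β).det := by
  have : (Matrix.of fun i j => β (p i) (q j)) =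
      (a.toMatrix p).transpose * LinearMap.BilinForm.toMatrix a β * a.toMatrix q := by
    ext i j
    simp only [Matrix.of_apply, Matrix.mul_apply, Matrix.transpose_apply,
      LinearMap.BilinForm.toMatrix_apply, Module.Basis.toMatrix_apply]
    conv_lhs => rw [← a.sum_repr (p i), ← a.sum_repr (q j)]
    simp only [map_sum, map_smul, LinearMap.sum_apply, LinearMap.smul_apply, smul_eq_mul,
      Finset.sum_mul, Finset.mul_sum]
    refine Finset.sum_congr rfl fun k _ => Finset.sum_congr rfl fun l _ => by ring
  rw [this, Matrix.det_mul, Matrix.det_mul, Matrix.det_transpose, Module.Basis.det_apply,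
    Module.Basis.det_apply]
  ring

/-- Burnside's theorem: over an algebraically closed field, a set of endomorphisms without
nontrivial common invariant subspaces generates the algebra of all endomorphisms. -/
theorem Module.End.adjoin_eq_top_of_irreducible [IsAlgClosed F] [FiniteDimensional F V]
    [Nontrivial V] (s : Set (Module.End F V))
    (hs : ∀ W : Submodule F V, (∀ f ∈ s, ∀ w ∈ W, f w ∈ W) → W = ⊥ ∨ W = ⊤) :
    Algebra.adjoin F s = ⊤ := by
  classical
  let A := Algebra.adjoin F s
  have hsimple : IsSimpleModule A V := by
    refine { exists_pair_ne := ⟨⊥, ⊤, bot_ne_top⟩, eq_bot_or_eq_top := fun W => ?_ }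
    have hW := hs (W.restrictScalars F) fun f hf w hw =>
      W.smul_mem (⟨f, Algebra.subset_adjoin hf⟩ : A) hw
    simpa using hW
  have hbij := IsSimpleModule.algebraMap_end_bijective_of_isAlgClosed (A := A) (V := V) F
  refine Algebra.eq_top_iff.2 fun f => ?_
  -- By Schur's lemma the commutant of `A` is `F`, so every `f` is linear over it; density then
  -- gives an element of `A` that agrees with `f` on a basis.
  let g : Module.End (Module.End A V) V :=
    { toFun := f
      map_add' := f.map_add
      map_smul' := fun e v => by
        obtain ⟨c, rfl⟩ := hbij.2 e
        simp }
  let b := Module.finBasis F V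
  obtain ⟨r, hr⟩ := jacobson_density g (Finset.univ.image b)
  have : f = (r : Module.End F V) := b.ext fun i => hr _ (Finset.mem_image_of_mem _ (Finset.mem_univ i))
  rw [this]
  exact r.2

end LinearAlgebra

/-! ### The trace form of a semisimple algebra -/

section TraceForm

variable (F : Type*) {B : Type*} [Field F] [NonUnitalRing B] [Module F B]
  [IsScalarTower F B B] [SMulCommClass F B B]

/-- The trace of the left multiplication by an element of an algebra. -/
noncomputable def mulLeftTrace : B →ₗ[F] F :=
  LinearMap.trace F B ∘ₗ LinearMap.mul F B

/-- The trace form of an algebra. -/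
noncomputable def algTraceForm (B : Type*) [NonUnitalRing B] [Module F B]
    [IsScalarTower F B B] [SMulCommClass F B B] : LinearMap.BilinForm F B :=
  (LinearMap.mul F B).compr₂ (mulLeftTrace F)

theorem mulLeftTrace_apply (b : B) :
    mulLeftTrace F b = LinearMap.trace F B (LinearMap.mulLeft F b) := rfl

theorem algTraceForm_apply (b c : B) : algTraceForm F B b c = mulLeftTrace F (b * c) := rfl

theorem mulLeftTrace_mul_comm (b c : B) : mulLeftTrace F (b * c) = mulLeftTrace F (c * b) := by
  rw [mulLeftTrace_apply, mulLeftTrace_apply, LinearMap.mulLeft_mul, LinearMap.mulLeft_mul]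
  exact LinearMap.trace_mul_comm F _ _

theorem algTraceForm_comm (b c : B) : algTraceForm F B b c = algTraceForm F B c b :=
  mulLeftTrace_mul_comm F b c

/-- In the unitization `c ^ (k + 1) = L_c ^ k c`, so `c` is nilpotent and `1 + c` is invertible. -/
theorem isQuasiregular_of_isNilpotent_mulLeft {c : B} (hc : IsNilpotent (LinearMap.mulLeft F c)) :
    IsQuasiregular c := by
  obtain ⟨n, hn⟩ := hc
  rw [← Unitization.isQuasiregular_inr_iff (R := F), isQuasiregular_iff_isUnit]
  refine IsNilpotent.isUnit_one_add ⟨n + 1, ?_⟩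
  have h : ∀ k : ℕ, (c : Unitization F B) ^ (k + 1) = ((LinearMap.mulLeft F c ^ k) c : B) := by
    intro k
    induction k with
    | zero => simp
    | succ k ih => rw [pow_succ', ih, pow_succ', ← Unitization.inr_mul]; rfl
  rw [h, hn]
  simp

variable [CharZero F] [FiniteDimensional F B]

/-- Every positive power of `bx` has the form `dx`, hence trace `0`. So `L_{bx}` is nilpotent for
every `b`, and `x` lies in the radical. -/
theorem eq_zero_of_algTraceForm_eq_zero (hss : IsSemisimpleAlg B) {x : B}
    (hx : ∀ b, algTraceForm F B x b = 0) : x = 0 := by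
  have : x ∈ jacobsonRadical B := fun b => by
    refine isQuasiregular_of_isNilpotent_mulLeft F
      (Module.End.isNilpotent_of_trace_pow_eq_zero _ fun n => ?_)
    have h : ∀ k : ℕ, ∃ d : B, LinearMap.mulLeft F (b * x) ^ (k + 1) = LinearMap.mulLeft F (d * x) := by
      intro k
      induction k with
      | zero => exact ⟨b, by simp⟩
      | succ k ih =>
        obtain ⟨d, hd⟩ := ih
        refine ⟨d * x * b, ?_⟩
        rw [pow_succ, hd]
        ext y
        simp [mul_assoc]
    obtain ⟨d, hd⟩ := h n
    rw [hd, ← mulLeftTrace_apply, mulLeftTrace_mul_comm]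
    exact hx d
  rwa [hss] at this

theorem algTraceForm_nondegenerate (hss : IsSemisimpleAlg B) : (algTraceForm F B).Nondegenerate :=
  ⟨fun _ hx => eq_zero_of_algTraceForm_eq_zero F hss hx, fun _ hx =>
    eq_zero_of_algTraceForm_eq_zero F hss fun b => (algTraceForm_comm F _ b).trans (hx b)⟩

/-- The unit has trace `dim B ≠ 0`, and adding it to a traceless element gives nonzero trace. Hence
multiplications may be restricted to constants whose traces can later be divided out. -/
theorem span_mulLeftTrace_ne_zero [Nontrivial B] {e : B} (he : ∀ b : B, e * b = b) :
    Submodule.span F {b : B | mulLeftTrace F b ≠ 0} = ⊤ := by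
  have he1 : mulLeftTrace F e ≠ 0 := by
    have : LinearMap.mulLeft F e = LinearMap.id := LinearMap.ext he
    rw [mulLeftTrace_apply, this, LinearMap.trace_id]
    exact Nat.cast_ne_zero.2 Module.finrank_pos.ne'
  refine Submodule.eq_top_iff'.2 fun b => ?_
  by_cases hb : mulLeftTrace F b = 0
  · rw [← add_sub_cancel_right b e]
    refine Submodule.sub_mem _ (Submodule.subset_span ?_) (Submodule.subset_span he1)
    simpa [hb] using he1
  · exact Submodule.subset_span hb

end TraceForm

/-- A finite dimensional semisimple algebra in characteristic zero has a unit. -/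
theorem exists_unit_of_isSemisimpleAlg (F : Type*) {B : Type*} [Field F] [NonUnitalRing B]
    [Module F B] [IsScalarTower F B B] [SMulCommClass F B B] [CharZero F] [FiniteDimensional F B]
    (hss : IsSemisimpleAlg B) :
    ∃ e : B, ∀ b : B, e * b = b ∧ b * e = b := by
  have hinj : Function.Injective (algTraceForm F B) := by
    rw [injective_iff_map_eq_zero]
    exact fun x hx => eq_zero_of_algTraceForm_eq_zero F hss fun b => by rw [hx]; rfl
  have hsurj : Function.Surjective (algTraceForm F B) :=
    (LinearMap.injective_iff_surjective_of_finrank_eq_finrank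
      (Subspace.dual_finrank_eq (K := F) (V := B)).symm).1 hinj
  -- The unit is the element that represents the trace functional: `tr(ebc) = tr(bc)` for all `c`
  -- forces `eb = b`.
  obtain ⟨e, he⟩ := hsurj (mulLeftTrace F)
  have he' : ∀ b, mulLeftTrace F (e * b) = mulLeftTrace F b := fun b => congr($he b)
  refine ⟨e, fun b => ⟨?_, ?_⟩⟩
  · rw [← sub_eq_zero]
    refine eq_zero_of_algTraceForm_eq_zero F hss fun c => ?_
    rw [map_sub, LinearMap.sub_apply, algTraceForm_apply, algTraceForm_apply, mul_assoc, he',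
      sub_self]
  · rw [← sub_eq_zero]
    refine eq_zero_of_algTraceForm_eq_zero F hss fun c => ?_
    rw [map_sub, LinearMap.sub_apply, algTraceForm_apply, algTraceForm_apply, mul_assoc,
      mulLeftTrace_mul_comm, mul_assoc, he', mulLeftTrace_mul_comm, sub_self]

/-! ### Irreducibility of an `H`-simple algebra -/

section GeneralizedAction

variable {F H B : Type*} [Field F] [IsAlgClosed F] [Ring H] [Algebra F H] [NonUnitalRing B]
  [Module F B] [IsScalarTower F B B] [SMulCommClass F B B] [FiniteDimensional F B]

/-- On an `H`-simple algebra, the operators of the action together with the multiplications by the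
elements of a spanning set generate all endomorphisms. -/
theorem IsHSimple.adjoin_eq_top {ρ : H →ₐ[F] Module.End F B} (hρ : IsHSimple ρ) {s : Set B}
    (hs : Submodule.span F s = ⊤) :
    Algebra.adjoin F (Set.range ρ ∪ (LinearMap.mulLeft F '' s ∪ LinearMap.mulRight F '' s)) = ⊤ := by
  have := hρ.1
  refine Module.End.adjoin_eq_top_of_irreducible _ fun W hW => hρ.2 W ⟨fun b w hw => ?_,
    fun h w hw => hW _ (Or.inl ⟨h, rfl⟩) w hw⟩
  have hb : b ∈ Submodule.span F s := hs ▸ Submodule.mem_top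
  constructor
  · have : Submodule.span F s ≤ W.comap (LinearMap.mulRight F w) :=
      Submodule.span_le.2 fun c hc => hW (LinearMap.mulLeft F c) (Or.inr (Or.inl ⟨c, hc, rfl⟩)) w hw
    exact this hb
  · have : Submodule.span F s ≤ W.comap (LinearMap.mulLeft F w) :=
      Submodule.span_le.2 fun c hc =>
        hW (LinearMap.mulRight F c) (Or.inr (Or.inr ⟨c, hc, rfl⟩)) w hw
    exact this hb

end GeneralizedAction

/-! ### Functions given by `H`-polynomials with constants -/

/-- `MultihomPoly ρ m c Φ` says that the function `Φ` of the variables in `X` is given by an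
`H`-polynomial with constants from `B`, each of whose monomials contains the variables with the
multiplicities prescribed by `m` and the constants with those prescribed by `c`. -/
inductive MultihomPoly {F H B X : Type*} [Field F] [Ring H] [Algebra F H] [NonUnitalRing B]
    [Module F B] (ρ : H →ₐ[F] Module.End F B) :
    Multiset X → Multiset B → ((X → B) → B) → Prop
  | var (v : X) : MultihomPoly ρ {v} 0 fun x => x v
  | const (b : B) : MultihomPoly ρ 0 {b} fun _ => b
  | mul {m₁ m₂ : Multiset X} {c₁ c₂ : Multiset B} {Φ₁ Φ₂ : (X → B) → B} :
      MultihomPoly ρ m₁ c₁ Φ₁ → MultihomPoly ρ m₂ c₂ Φ₂ →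
        MultihomPoly ρ (m₁ + m₂) (c₁ + c₂) fun x => Φ₁ x * Φ₂ x
  | act (h : H) {m : Multiset X} {c : Multiset B} {Φ : (X → B) → B} :
      MultihomPoly ρ m c Φ → MultihomPoly ρ m c fun x => ρ h (Φ x)
  | add {m : Multiset X} {c : Multiset B} {Φ₁ Φ₂ : (X → B) → B} :
      MultihomPoly ρ m c Φ₁ → MultihomPoly ρ m c Φ₂ → MultihomPoly ρ m c fun x => Φ₁ x + Φ₂ x
  | smul (r : F) {m : Multiset X} {c : Multiset B} {Φ : (X → B) → B} :
      MultihomPoly ρ m c Φ → MultihomPoly ρ m c fun x => r • Φ x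

/-- Gives the added degree when something of degree `r` is inserted at each occurrence of the one
variable `w`. -/
theorem Multiset.bind_ite_eq_count_nsmul {α β : Type*} [DecidableEq α] (m : Multiset α) (w : α)
    (r : Multiset β) : (m.bind fun v => if v = w then r else 0) = m.count w • r := by
  induction m using Multiset.induction_on with
  | empty => simp
  | cons v m ih =>
    rw [Multiset.cons_bind, ih, Multiset.count_cons, add_smul, add_comm]
    by_cases h : v = w
    · simp [h]
    · simp [h, Ne.symm h]

namespace MultihomPoly

variable {F H B X : Type*} [Field F] [Ring H] [Algebra F H] [NonUnitalRing B]
    [Module F B] {ρ : H →ₐ[F] Module.End F B} {m : Multiset X} {c : Multiset B} {Φ : (X → B) → B}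

theorem of_eq {m' : Multiset X} {c' : Multiset B} {Φ' : (X → B) → B} (h : MultihomPoly ρ m c Φ)
    (hm : m = m') (hc : c = c') (hΦ : ∀ x, Φ x = Φ' x) : MultihomPoly ρ m' c' Φ' := by
  obtain rfl : Φ = Φ' := funext hΦ
  exact hm ▸ hc ▸ h

/-- Nonemptiness matters: in degree `m = 0`, `c = 0` not even the zero function qualifies. -/
theorem sum {ι : Type*} {s : Finset ι} (hs : s.Nonempty) {Φ : ι → (X → B) → B}
    (h : ∀ i ∈ s, MultihomPoly ρ m c (Φ i)) : MultihomPoly ρ m c fun x => ∑ i ∈ s, Φ i x := by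
  classical
  have := Finset.sum_induction_nonempty Φ (MultihomPoly ρ m c) (fun _ _ => .add) hs h
  exact this.of_eq rfl rfl fun x => Finset.sum_apply x s Φ

theorem subst {Y : Type*} (h : MultihomPoly ρ m c Φ) {g : X → Multiset Y} {d : X → Multiset B}
    {G : X → (Y → B) → B} (hG : ∀ v, MultihomPoly ρ (g v) (d v) (G v)) :
    MultihomPoly ρ (m.bind g) (c + m.bind d) fun x => Φ fun v => G v x := by
  induction h with
  | var v => exact (hG v).of_eq (by simp) (by simp) fun _ => rfl
  | const b => exact (const b).of_eq (by simp) (by simp) fun _ => rfl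
  | mul _ _ ih₁ ih₂ =>
    exact (ih₁.mul ih₂).of_eq (by simp) (by rw [Multiset.add_bind]; abel) fun _ => rfl
  | act h _ ih => exact ih.act h
  | add _ _ ih₁ ih₂ => exact ih₁.add ih₂
  | smul r _ ih => exact ih.smul r

variable {n : Type*} [Fintype n] [DecidableEq n]

/-! ### The trace trick -/

section Trace

variable [Nonempty n] {b : n → X} {Ψ : (X → B) → B} {a : Module.Basis n F B}

/-- If `Φ` is the determinant of a block of variables times something that does not depend on this
block, then `Φ` can be multiplied by the trace of an operator. -/
theorem trace_smul (hb : Function.Injective b) (hbm : ∀ i, b i ∉ m)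
    (hΨ : ∀ x y : X → B, (∀ v, v ∉ Set.range b → x v = y v) → Ψ x = Ψ y)
    (h : MultihomPoly ρ (Finset.univ.val.map b + m) c fun x => a.det (fun i => x (b i)) • Ψ x)
    {r : Multiset X} {d : Multiset B} {u : (X → B) → Module.End F B}
    (hu : ∀ v, MultihomPoly ρ (v ::ₘ r) d fun x => u x (x v)) :
    MultihomPoly ρ (Finset.univ.val.map b + m + r) (c + d) fun x =>
      LinearMap.trace F B (u x) • a.det (fun i => x (b i)) • Ψ x := by
  classical
  -- Substitute `u x (x (b i))` for the variable `b i`. It occurs exactly once, so `r` and `d` are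
  -- added once; `Ψ` is unaffected because it ignores the block.
  have key : ∀ i, MultihomPoly ρ (Finset.univ.val.map b + m + r) (c + d) fun x =>
      a.det (Function.update (fun j => x (b j)) i (u x (x (b i)))) • Ψ x := fun i => by
    have hcount : (Finset.univ.val.map b + m).count (b i) = 1 := by
      rw [Multiset.count_add, Multiset.count_map_eq_count' _ _ hb,
        Multiset.count_eq_zero_of_notMem (hbm i), add_zero]
      exact Multiset.count_eq_one_of_mem Finset.univ.nodup (Finset.mem_univ i)
    have hG : ∀ v, MultihomPoly ρ ({v} + if v = b i then r else 0) (if v = b i then d else 0)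
        fun x => if v = b i then u x (x v) else x v := fun v => by
      by_cases hv : v = b i
      · simpa [hv] using hu (b i)
      · simpa [hv] using var v
    refine (h.subst hG).of_eq ?_ ?_ fun x => ?_
    · rw [Multiset.bind_add, Multiset.bind_singleton, Multiset.bind_ite_eq_count_nsmul, hcount]
      simp
    · rw [Multiset.bind_ite_eq_count_nsmul, hcount, one_smul]
    · congr 1
      · congr 1
        ext j
        by_cases hj : j = i
        · subst hj; simp
        · simp [hj, hb.eq_iff]
      · exact hΨ _ _ fun v hv => if_neg fun h => hv ⟨i, h.symm⟩
  refine (sum Finset.univ_nonempty fun i _ => key i).of_eq rfl rfl fun x => ?_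
  rw [← Finset.sum_smul, a.sum_det_update_eq_trace_mul, smul_smul]

variable [IsScalarTower F B B] [SMulCommClass F B B]

/-- The trace trick with left multiplications by constants. It enlarges the multiset of constants at
the price of a scalar, which is invertible if all their traces are nonzero. -/
theorem const_trace_smul (hb : Function.Injective b) (hbm : ∀ i, b i ∉ m)
    (hΨ : ∀ x y : X → B, (∀ v, v ∉ Set.range b → x v = y v) → Ψ x = Ψ y)
    (h : MultihomPoly ρ (Finset.univ.val.map b + m) c fun x => a.det (fun i => x (b i)) • Ψ x)
    (e : Multiset B) :
    MultihomPoly ρ (Finset.univ.val.map b + m) (c + e) fun x =>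
      (e.map (mulLeftTrace F)).prod • a.det (fun i => x (b i)) • Ψ x := by
  induction e using Multiset.induction_on with
  | empty => simpa using h
  | cons y e ih =>
    have ih' : MultihomPoly ρ (Finset.univ.val.map b + m) (c + e) fun x =>
        a.det (fun i => x (b i)) • (e.map (mulLeftTrace F)).prod • Ψ x :=
      ih.of_eq rfl rfl fun x => smul_comm _ _ _
    have hy : ∀ v : X, MultihomPoly ρ (v ::ₘ 0) {y} fun x => LinearMap.mulLeft F y (x v) :=
      fun v => ((const y).mul (var v)).of_eq (by simp) (by simp) fun _ => rfl
    refine (ih'.trace_smul (u := fun _ => LinearMap.mulLeft F y) hb hbm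
      (fun x x' hx => by rw [hΨ x x' hx]) hy).of_eq (by simp) ?_ fun x => ?_
    · rw [add_assoc, add_comm e, Multiset.singleton_add]
    · rw [smul_comm (a.det _), smul_smul, Multiset.map_cons, Multiset.prod_cons,
        mulLeftTrace_apply]

/-- The trace trick with `L_{pq}`, whose trace is the trace form at `p, q`. As `p` and `q` lie
outside the block, the new scalar does not depend on the block and the trick can be repeated. -/
theorem prod_traceForm_smul (hb : Function.Injective b) (hbm : ∀ i, b i ∉ m)
    (hΨ : ∀ x y : X → B, (∀ v, v ∉ Set.range b → x v = y v) → Ψ x = Ψ y)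
    (h : MultihomPoly ρ (Finset.univ.val.map b + m) c fun x => a.det (fun i => x (b i)) • Ψ x)
    {ι : Type*} (s : Finset ι) (p q : ι → X) (hp : ∀ i ∈ s, p i ∉ Set.range b)
    (hq : ∀ i ∈ s, q i ∉ Set.range b) :
    MultihomPoly ρ (Finset.univ.val.map b + m + (s.val.map p + s.val.map q)) c fun x =>
      (∏ i ∈ s, algTraceForm F B (x (p i)) (x (q i))) • a.det (fun i => x (b i)) • Ψ x := by
  classical
  induction s using Finset.induction_on with
  | empty => simpa using h
  | insert j s hj ih =>
    have ih' : MultihomPoly ρ (Finset.univ.val.map b + (m + (s.val.map p + s.val.map q))) c fun x =>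
        a.det (fun i => x (b i)) •
          (∏ i ∈ s, algTraceForm F B (x (p i)) (x (q i))) • Ψ x :=
      (ih (fun i hi => hp i (Finset.mem_insert_of_mem hi))
        (fun i hi => hq i (Finset.mem_insert_of_mem hi))).of_eq (add_assoc _ _ _) rfl
        fun x => smul_comm _ _ _
    have hy : ∀ v : X, MultihomPoly ρ (v ::ₘ {p j, q j}) 0
        fun x => LinearMap.mulLeft F (x (p j) * x (q j)) (x v) :=
      fun v => (((var (p j)).mul (var (q j))).mul (var v)).of_eq
        (by rw [add_comm]; rfl) (by simp) fun _ => rfl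
    refine (ih'.trace_smul (u := fun x => LinearMap.mulLeft F (x (p j) * x (q j)))
      hb (fun i hi => ?_) (fun x y hxy => ?_) hy).of_eq ?_ (add_zero c) fun x => ?_
    · simp only [Multiset.mem_add, Multiset.mem_map, Finset.mem_val] at hi
      rcases hi with hi | ⟨k, hk, hki⟩ | ⟨k, hk, hki⟩
      · exact hbm i hi
      · exact hp k (Finset.mem_insert_of_mem hk) ⟨i, hki.symm⟩
      · exact hq k (Finset.mem_insert_of_mem hk) ⟨i, hki.symm⟩
    · rw [hΨ x y hxy, Finset.prod_congr rfl fun i hi => by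
        rw [hxy _ (hp i (Finset.mem_insert_of_mem hi)), hxy _ (hq i (Finset.mem_insert_of_mem hi))]]
    · rw [Finset.insert_val_of_notMem hj, Multiset.map_cons, Multiset.map_cons,
        ← Multiset.singleton_add (p j), ← Multiset.singleton_add (q j), Multiset.insert_eq_cons,
        ← Multiset.singleton_add (p j)]
      abel
    · rw [smul_comm (a.det _), smul_smul, Finset.prod_insert hj, algTraceForm_apply,
        mulLeftTrace_apply]

/-- Two more blocks of variables can be adjoined without new constants. -/
theorem det_smul_det_smul [FiniteDimensional F B] [CharZero F] (hss : IsSemisimpleAlg B)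
    (hb : Function.Injective b) (hbm : ∀ i, b i ∉ m)
    (hΨ : ∀ x y : X → B, (∀ v, v ∉ Set.range b → x v = y v) → Ψ x = Ψ y)
    (h : MultihomPoly ρ (Finset.univ.val.map b + m) c fun x => a.det (fun i => x (b i)) • Ψ x)
    (p q : n → X) (hp : ∀ i, p i ∉ Set.range b) (hq : ∀ i, q i ∉ Set.range b) :
    MultihomPoly ρ (Finset.univ.val.map b + m + (Finset.univ.val.map p + Finset.univ.val.map q)) c
      fun x => (a.det (fun i => x (p i)) * a.det (fun i => x (q i))) •
        a.det (fun i => x (b i)) • Ψ x := by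
  set D := (LinearMap.BilinForm.toMatrix a (algTraceForm F B)).det
  have hD : D ≠ 0 := (LinearMap.BilinForm.nondegenerate_iff_det_ne_zero a).1
    (algTraceForm_nondegenerate F hss)
  -- One term of the Leibniz expansion of the Gram determinant. All terms have the same degree, so
  -- they may be summed.
  have key : ∀ σ : Equiv.Perm n, MultihomPoly ρ
      (Finset.univ.val.map b + m + (Finset.univ.val.map p + Finset.univ.val.map q)) c fun x =>
        (Equiv.Perm.sign σ : F) • (∏ i, algTraceForm F B (x (p (σ i))) (x (q i))) •
          a.det (fun i => x (b i)) • Ψ x := fun σ => by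
    refine ((h.prod_traceForm_smul hb hbm hΨ Finset.univ (fun i => p (σ i)) q (fun i _ => hp _)
      (fun i _ => hq _)).smul _).of_eq ?_ rfl fun x => rfl
    congr 2
    rw [← Function.comp_def p, ← Multiset.map_map]
    congr 1
    exact (Finset.map_val σ.toEmbedding Finset.univ).symm.trans
      (congrArg Finset.val (Finset.map_univ_equiv σ))
  refine ((sum Finset.univ_nonempty fun σ _ => key σ).smul D⁻¹).of_eq rfl rfl fun x => ?_
  have hdet := LinearMap.BilinForm.det_gram a (algTraceForm F B) (fun i => x (p i))
    (fun i => x (q i))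
  rw [Matrix.det_apply'] at hdet
  simp only [Matrix.of_apply] at hdet
  simp_rw [smul_smul (Equiv.Perm.sign _ : F)]
  rw [← Finset.sum_smul, hdet, smul_smul, mul_comm, mul_assoc, mul_inv_cancel₀ hD, mul_one]

end Trace

end MultihomPoly

/-! ### Alternating products of operators -/

section AlternatingProduct

variable {F V W : Type*} [Field F] [AddCommGroup V] [Module F V] [AddCommGroup W] [Module F W]
  {n : ℕ}

/-- The alternating sum of the operators `w 0 * φ (x (σ 0)) * w 1 * φ (x (σ 1)) * ⋯` over all
permutations `σ`. -/
noncomputable def alternatingProduct (φ : V →ₗ[F] Module.End F W) (w : Fin n → Module.End F W) :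
    V [⋀^Fin n]→ₗ[F] Module.End F W :=
  MultilinearMap.alternatization ((MultilinearMap.mkPiAlgebraFin F n (Module.End F W)).compLinearMap
    fun i => LinearMap.mulLeft F (w i) ∘ₗ φ)

theorem alternatingProduct_apply (φ : V →ₗ[F] Module.End F W) (w : Fin n → Module.End F W)
    (x : Fin n → V) : alternatingProduct φ w x =
      ∑ σ : Equiv.Perm (Fin n), (Equiv.Perm.sign σ : F) •
        (List.ofFn fun i => w i * φ (x (σ i))).prod := by
  rw [alternatingProduct, MultilinearMap.alternatization_apply]
  refine Finset.sum_congr rfl fun σ _ => ?_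
  rw [Units.smul_def, ← Int.cast_smul_eq_zsmul F]
  simp

/-- If all alternating products with factors from a spanning set vanish at `x`, then so do all the
alternating products. -/
theorem alternatingProduct_eq_zero_of_span [FiniteDimensional F W] (φ : V →ₗ[F] Module.End F W)
    {s : Set (Module.End F W)} (hs : ⊤ ≤ Submodule.span F s) (x : Fin n → V)
    (h : ∀ w : Fin n → Module.End F W, (∀ i, w i ∈ s) → alternatingProduct φ w x = 0)
    (w : Fin n → Module.End F W) : alternatingProduct φ w x = 0 := by
  -- For fixed `x` the product is multilinear in `w`, so a basis chosen from `s` decides whether it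
  -- vanishes.
  let M : MultilinearMap F (fun _ : Fin n => Module.End F W) (Module.End F W) :=
    ∑ σ : Equiv.Perm (Fin n), (Equiv.Perm.sign σ : F) •
      (MultilinearMap.mkPiAlgebraFin F n (Module.End F W)).compLinearMap
        fun i => LinearMap.mulRight F (φ (x (σ i)))
  have hM : ∀ w, M w = alternatingProduct φ w x := fun w => by
    rw [alternatingProduct_apply]
    simp [M]
  have hM0 : M = 0 := Module.Basis.ext_multilinear (fun _ => Module.Basis.ofSpan hs) fun v => by
    rw [hM]
    exact h _ fun i => Module.Basis.ofSpan_subset hs ⟨v i, rfl⟩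
  rw [← hM, hM0]
  rfl

variable {B : Type*} [NonUnitalRing B] [Module F B] [IsScalarTower F B B] [SMulCommClass F B B]

/-- Since `w i * L_b` sends `e` to the `i`-th coordinate of `b` times `e`, the value on `e` is the
determinant of the identity matrix times `e`. -/
theorem alternatingProduct_coord_ne_zero [Nontrivial B] (a : Module.Basis (Fin n) F B) {e : B}
    (he : ∀ b : B, b * e = b) :
    alternatingProduct (LinearMap.mul F B) (fun i => (a.coord i).smulRight e) a ≠ 0 := by
  have he0 : e ≠ 0 := by
    rintro rfl
    obtain ⟨b, hb⟩ := exists_ne (0 : B)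
    exact hb (by rw [← he b, mul_zero])
  have hprod : ∀ y : Fin n → B, ∀ k (f : Fin k → Fin n),
      (List.ofFn fun i => (a.coord (f i)).smulRight e * LinearMap.mul F B (y (f i))).prod e =
        (∏ i, a.coord (f i) (y (f i))) • e := by
    intro y k
    induction k with
    | zero => intro f; simp
    | succ k ih =>
      intro f
      rw [List.ofFn_succ, List.prod_cons, Module.End.mul_apply, ih fun i => f i.succ,
        Fin.prod_univ_succ, map_smul, mul_comm, mul_smul]
      simp [he]
  have : alternatingProduct (LinearMap.mul F B) (fun i => (a.coord i).smulRight e) a e = e := by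
    rw [alternatingProduct_apply, LinearMap.sum_apply]
    have h1 : ∀ σ : Equiv.Perm (Fin n), ((Equiv.Perm.sign σ : F) • (List.ofFn fun i =>
        (a.coord i).smulRight e * LinearMap.mul F B (a (σ i))).prod) e =
        ((Equiv.Perm.sign σ : F) * ∏ i, (1 : Matrix (Fin n) (Fin n) F) (σ i) i) • e := fun σ => by
      have h2 := hprod (fun i => a (σ i)) n id
      simp only [id] at h2
      rw [LinearMap.smul_apply, h2, smul_smul]
      congr 2
      refine Finset.prod_congr rfl fun i _ => ?_
      simp [Matrix.one_apply, Finsupp.single_apply]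
    rw [Finset.sum_congr rfl fun σ _ => h1 σ, ← Finset.sum_smul, ← Matrix.det_apply',
      Matrix.det_one, one_smul]
  intro h0
  rw [h0] at this
  exact he0 this.symm

end AlternatingProduct

/-! ### Operators realized with constants of nonzero trace -/

section Realizable

variable {F H B : Type*} [Field F] [Ring H] [Algebra F H] [NonUnitalRing B]
    [Module F B] [IsScalarTower F B B] [SMulCommClass F B B] (ρ : H →ₐ[F] Module.End F B)
    (X : Type*)

/-- The operators `w` that can be applied to the value of an `H`-polynomial at the cost of finitely
many constants with nonzero trace. -/
def realizableOperators : Submonoid (Module.End F B) where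
  carrier := {w | ∃ d : Multiset B, (∀ y ∈ d, mulLeftTrace F y ≠ 0) ∧
    ∀ (m : Multiset X) (c : Multiset B) (Φ : (X → B) → B), MultihomPoly ρ m c Φ →
      MultihomPoly ρ m (c + d) fun x => w (Φ x)}
  one_mem' := ⟨0, by simp, fun m c Φ h => h.of_eq rfl (add_zero c).symm fun _ => rfl⟩
  mul_mem' := by
    rintro w₁ w₂ ⟨d₁, hd₁, h₁⟩ ⟨d₂, hd₂, h₂⟩
    refine ⟨d₂ + d₁, fun y hy => ?_, fun m c Φ h =>
      (h₁ _ _ _ (h₂ _ _ _ h)).of_eq rfl (add_assoc _ _ _) fun _ => rfl⟩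
    rcases Multiset.mem_add.1 hy with hy | hy
    exacts [hd₂ y hy, hd₁ y hy]

/-- The action and the multiplications by elements of nonzero trace are realizable; the algebra they
generate is all of `End(B)` and is spanned by their products. -/
theorem span_realizableOperators [IsAlgClosed F] [CharZero F] [FiniteDimensional F B]
    (hρ : IsHSimple ρ) (hss : IsSemisimpleAlg B) :
    Submodule.span F (realizableOperators ρ X : Set (Module.End F B)) = ⊤ := by
  have := hρ.1
  obtain ⟨e, he⟩ := exists_unit_of_isSemisimpleAlg F hss
  have htop := hρ.adjoin_eq_top (span_mulLeftTrace_ne_zero F fun b => (he b).1)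
  have hle : Subalgebra.toSubmodule (Algebra.adjoin F (Set.range ρ ∪
      (LinearMap.mulLeft F '' {b : B | mulLeftTrace F b ≠ 0} ∪
        LinearMap.mulRight F '' {b : B | mulLeftTrace F b ≠ 0}))) ≤
      Submodule.span F (realizableOperators ρ X : Set (Module.End F B)) := by
    rw [Algebra.adjoin_eq_span]
    refine Submodule.span_mono ?_
    refine (Submonoid.closure_le (S := realizableOperators ρ X)).2 ?_
    rintro _ (⟨h, rfl⟩ | ⟨b, hb, rfl⟩ | ⟨b, hb, rfl⟩)
    · exact ⟨0, by simp, fun m c Φ hΦ => (hΦ.act h).of_eq rfl (add_zero c).symm fun _ => rfl⟩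
    · exact ⟨{b}, by simpa using hb, fun m c Φ hΦ =>
        ((MultihomPoly.const b).mul hΦ).of_eq (zero_add m) (add_comm _ _) fun _ => rfl⟩
    · exact ⟨{b}, by simpa using hb, fun m c Φ hΦ =>
        (hΦ.mul (MultihomPoly.const b)).of_eq (add_zero m) rfl fun _ => rfl⟩
  rw [htop] at hle
  exact top_le_iff.1 (by simpa using hle)

end Realizable

/-! ### One determinant times a variable -/

namespace MultihomPoly

variable {F H B X : Type*} [Field F] [Ring H] [Algebra F H] [NonUnitalRing B]
    [Module F B] [IsScalarTower F B B] [SMulCommClass F B B] {ρ : H →ₐ[F] Module.End F B}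

/-- The constants depend on `w` alone and not on the variables, so the terms for different
permutations of the variables can be added. -/
theorem list_prod {n : ℕ} (w : Fin n → Module.End F B) (hw : ∀ i, w i ∈ realizableOperators ρ X) :
    ∃ d : Multiset B, (∀ y ∈ d, mulLeftTrace F y ≠ 0) ∧
      ∀ (v : Fin n → X) (z : X), MultihomPoly ρ (Finset.univ.val.map v + {z}) d
        fun x => (List.ofFn fun i => w i * LinearMap.mul F B (x (v i))).prod (x z) := by
  induction n with
  | zero => exact ⟨0, by simp, fun v z => by simpa using var z⟩
  | succ n ih =>
    obtain ⟨d, hd, h⟩ := ih (fun i => w i.succ) fun i => hw _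
    obtain ⟨d', hd', h'⟩ := hw 0
    refine ⟨d + d', fun y hy => ?_, fun v z => ?_⟩
    · rcases Multiset.mem_add.1 hy with hy | hy
      exacts [hd y hy, hd' y hy]
    · refine (h' _ _ _ ((var (v 0)).mul (h (fun i => v i.succ) z))).of_eq ?_ (by simp) fun x => ?_
      · simp only [Fin.univ_val_map, List.ofFn_succ, ← Multiset.cons_coe, ← Multiset.singleton_add,
          add_assoc]
      · simp [List.ofFn_succ]

variable [IsAlgClosed F] [CharZero F] [FiniteDimensional F B] {n : ℕ}

/-- For an `H`-simple algebra, there is an `H`-polynomial with constants whose value is the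
determinant of a block of variables times a further variable. -/
theorem exists_det_smul (hρ : IsHSimple ρ) (hss : IsSemisimpleAlg B) (a : Module.Basis (Fin n) F B)
    {b : Fin n → X} (hb : Function.Injective b) {z : X} (hz : z ∉ Set.range b) :
    ∃ c : Multiset B, MultihomPoly ρ (Finset.univ.val.map b + {z}) c
      fun x => a.det (fun i => x (b i)) • x z := by
  have := hρ.1
  have : Nonempty (Fin n) := a.index_nonempty
  let P : Multiset B → Module.End F B → Prop := fun c E =>
    MultihomPoly ρ (Finset.univ.val.map b + {z}) c fun x => a.det (fun i => x (b i)) • E (x z)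
  -- The goal is `1 ∈ S`; it suffices that `S` is a nonzero two-sided ideal of `End(B)`.
  let S : Set (Module.End F B) := {E | ∃ c, (∀ y ∈ c, mulLeftTrace F y ≠ 0) ∧ P c E}
  have hgood : ∀ c d : Multiset B, (∀ y ∈ c, mulLeftTrace F y ≠ 0) →
      (∀ y ∈ d, mulLeftTrace F y ≠ 0) → ∀ y ∈ c + d, mulLeftTrace F y ≠ 0 := by
    intro c d hc hd y hy
    rcases Multiset.mem_add.1 hy with hy | hy
    exacts [hc y hy, hd y hy]
  -- Extra constants multiply the function by the product of their traces, which is then divided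
  -- out. This lets two members of `S` share one multiset of constants.
  have habsorb : ∀ c d E, (∀ y ∈ d, mulLeftTrace F y ≠ 0) → P c E → P (c + d) E := by
    intro c d E hd h
    have h' := const_trace_smul hb (fun i hi => hz ⟨i, by simpa using hi⟩)
      (fun x y hxy => by rw [hxy z hz]) h d
    refine (h'.smul (d.map (mulLeftTrace F)).prod⁻¹).of_eq rfl rfl fun x => ?_
    rw [smul_smul, inv_mul_cancel₀, one_smul]
    rw [Ne, Multiset.prod_eq_zero_iff, Multiset.mem_map]
    rintro ⟨y, hy, hy0⟩
    exact hd y hy hy0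
  have hadd : ∀ E₁ ∈ S, ∀ E₂ ∈ S, E₁ + E₂ ∈ S := by
    rintro E₁ ⟨c₁, hc₁, h₁⟩ E₂ ⟨c₂, hc₂, h₂⟩
    exact ⟨c₁ + c₂, hgood _ _ hc₁ hc₂, ((habsorb _ _ _ hc₂ h₁).add
      ((habsorb _ _ _ hc₁ h₂).of_eq rfl (add_comm _ _) fun _ => rfl)).of_eq rfl rfl fun x => by
        rw [← smul_add]; rfl⟩
  have hsmul : ∀ (r : F), ∀ E ∈ S, r • E ∈ S := by
    rintro r E ⟨c, hc, h⟩
    exact ⟨c, hc, (h.smul r).of_eq rfl rfl fun x => smul_comm _ _ _⟩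
  have hleft : ∀ w ∈ realizableOperators ρ X, ∀ E ∈ S, w * E ∈ S := by
    rintro w ⟨d, hd, hw⟩ E ⟨c, hc, h⟩
    exact ⟨c + d, hgood _ _ hc hd, (hw _ _ _ h).of_eq rfl rfl fun x => map_smul _ _ _⟩
  -- Right multiplication by `w` is the substitution of `w z` for `z`, which occurs once.
  have hright : ∀ w ∈ realizableOperators ρ X, ∀ E ∈ S, E * w ∈ S := by
    classical
    rintro w ⟨d, hd, hw⟩ E ⟨c, hc, h⟩
    have hG : ∀ v, MultihomPoly ρ {v} (if v = z then d else 0)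
        fun x => if v = z then w (x v) else x v := fun v => by
      by_cases hv : v = z
      · simpa [hv] using hw _ _ _ (var z)
      · simpa [hv] using var v
    refine ⟨c + d, hgood _ _ hc hd, (h.subst hG).of_eq ?_ ?_ fun x => ?_⟩
    · exact (Multiset.bind_singleton _ _).trans (Multiset.map_id' _)
    · have hz0 : (Finset.univ.val.map b).count z = 0 :=
        Multiset.count_eq_zero_of_notMem fun hi => hz (by simpa using hi)
      rw [Multiset.bind_ite_eq_count_nsmul, Multiset.count_add, hz0]
      simp
    · have hbz : ∀ i, b i ≠ z := fun i hi => hz ⟨i, hi⟩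
      simp [hbz]
  have hspan := span_realizableOperators ρ X hρ hss
  -- An alternating product with realizable factors equals `det(x)` times its value at the basis
  -- `a`, and that value lies in `S`. If all of them were zero, so would be every alternating
  -- product at `a`, the coordinate one included.
  obtain ⟨E₀, hE₀S, hE₀⟩ : ∃ E ∈ S, E ≠ 0 := by
    by_contra! hS
    obtain ⟨e, he⟩ := exists_unit_of_isSemisimpleAlg F hss
    refine alternatingProduct_coord_ne_zero a (fun y => (he y).2)
      (alternatingProduct_eq_zero_of_span _ hspan.ge _ (fun w hw => hS _ ?_) _)
    obtain ⟨d, hd, h⟩ := list_prod w hw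
    refine ⟨d, hd, (sum Finset.univ_nonempty fun σ _ =>
      ((h (fun i => b (σ i)) z).of_eq ?_ rfl fun _ => rfl).smul (Equiv.Perm.sign σ : F)).of_eq
        rfl rfl fun x => ?_⟩
    · congr 1
      rw [← Function.comp_def b, ← Multiset.map_map]
      congr 1
      exact (Finset.map_val σ.toEmbedding Finset.univ).symm.trans
        (congrArg Finset.val (Finset.map_univ_equiv σ))
    · rw [← LinearMap.smul_apply, ← AlternatingMap.eq_det_smul a, alternatingProduct_apply,
        LinearMap.sum_apply]
      rfl
  have h0 : (0 : Module.End F B) ∈ S := by simpa using hsmul 0 E₀ hE₀S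
  have hleft' : ∀ w, ∀ E ∈ S, w * E ∈ S := fun w E hE => by
    have hw : w ∈ Submodule.span F (realizableOperators ρ X : Set (Module.End F B)) :=
      hspan ▸ Submodule.mem_top
    induction hw using Submodule.span_induction with
    | mem w hw => exact hleft w hw E hE
    | zero => rwa [zero_mul]
    | add w₁ w₂ _ _ h₁ h₂ => rw [add_mul]; exact hadd _ h₁ _ h₂
    | smul r w _ h => rw [smul_mul_assoc]; exact hsmul r _ h
  have hright' : ∀ w, ∀ E ∈ S, E * w ∈ S := fun w E hE => by
    have hw : w ∈ Submodule.span F (realizableOperators ρ X : Set (Module.End F B)) :=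
      hspan ▸ Submodule.mem_top
    induction hw using Submodule.span_induction with
    | mem w hw => exact hright w hw E hE
    | zero => rwa [mul_zero]
    | add w₁ w₂ _ _ h₁ h₂ => rw [mul_add]; exact hadd _ h₁ _ h₂
    | smul r w _ h => rw [mul_smul_comm]; exact hsmul r _ h
  obtain ⟨y, hy⟩ : ∃ y, E₀ y ≠ 0 := by
    by_contra! hE
    exact hE₀ (LinearMap.ext hE)
  obtain ⟨f, hf⟩ := Module.Projective.exists_dual_eq_one F hy
  -- The rank-one operators on both sides turn `E₀` into `a i ⊗ a.coord i`, because `f (E₀ y) = 1`;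
  -- these sum to the identity.
  have hone : (1 : Module.End F B) =
      ∑ i, f.smulRight (a i) * E₀ * (a.coord i).smulRight y := by
    refine LinearMap.ext fun x => ?_
    simp [LinearMap.sum_apply, hf, a.sum_repr]
  have : (1 : Module.End F B) ∈ S := by
    rw [hone]
    exact Finset.sum_induction _ (· ∈ S) (fun E₁ E₂ h₁ h₂ => hadd _ h₁ _ h₂) h0
      fun i _ => hright' _ _ (hleft' _ _ hE₀S)
  obtain ⟨c, -, hc⟩ := this
  exact ⟨c, hc⟩

end MultihomPoly

/-- Equal multiplicities mean fibers of equal size. This matches the letters of a word with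
variables even when constants repeat. -/
theorem Multiset.exists_equiv_of_map_univ_eq {α ι β : Type*} [Fintype α] [Fintype ι] {u : α → β}
    {g : ι → β} (h : Finset.univ.val.map u = Finset.univ.val.map g) :
    ∃ e : α ≃ ι, ∀ i, g (e i) = u i := by
  classical
  have hcard : ∀ b, Fintype.card {i // u i = b} = Fintype.card {i // g i = b} := fun b => by
    have := congrArg (Multiset.count b) h
    simp only [Multiset.count_map] at this
    rw [Fintype.card_subtype, Fintype.card_subtype]
    simpa only [eq_comm] using! this
  exact ⟨Equiv.ofFiberEquiv fun b => Fintype.equivOfCardEq (hcard b),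
    fun i => Equiv.ofFiberEquiv_map _ i⟩

theorem Multiset.map_univ_eq_sum {ι β : Type*} [Fintype ι] (g : ι → β) :
    Finset.univ.val.map g = ∑ i, ({g i} : Multiset β) := by
  rw [← Multiset.sum_map_singleton (Finset.univ.val.map g), Multiset.map_map]
  rfl

theorem map_seqProd {M N : Type*} [Mul M] [Mul N] {G : Type*} [FunLike G M N] [MulHomClass G M N]
    (φ : G) (n : ℕ) (f : Fin (n + 1) → M) : φ (seqProd n f) = seqProd n fun i => φ (f i) := by
  induction n with
  | zero => rfl
  | succ n ih => rw [seqProd, map_mul, ih]; rfl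

theorem FreeSemigroup.lift_eq_seqProd {α M : Type*} [Semigroup M] (g : α → M) (x : α)
    (l : List α) :
    FreeSemigroup.lift g ⟨x, l⟩ = seqProd l.length fun i => g ((x :: l).get i) := by
  induction l generalizing x with
  | nil => rfl
  | cons y l ih =>
    have : (⟨x, y :: l⟩ : FreeSemigroup α) = FreeSemigroup.of x * ⟨y, l⟩ := rfl
    rw [this, map_mul, ih]
    rfl

/-! ### Evaluation and renaming of formal `H`-polynomials -/

namespace HPoly

section

variable {F ι Λ A A' : Type*} [Field F]
  [NonUnitalRing A] [Module F A] [IsScalarTower F A A] [SMulCommClass F A A]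
  [NonUnitalRing A'] [Module F A'] [IsScalarTower F A' A'] [SMulCommClass F A' A']

theorem lift_gen (g : ι × Λ → A) (i : ι) (β : Λ) : lift g (gen i β : HPoly F ι Λ) = g (i, β) := by
  simp [lift, gen]

theorem map_lift (φ : A →ₙₐ[F] A') (g : ι × Λ → A) (f : HPoly F ι Λ) :
    φ (lift g f) = lift (fun p => φ (g p)) f := by
  have : φ.comp (lift g) = lift (fun p => φ (g p)) := by
    refine MonoidAlgebra.nonUnitalAlgHom_ext' F (FreeSemigroup.hom_ext (funext fun p => ?_))
    exact (congrArg φ (lift_gen g p.1 p.2)).trans (lift_gen (fun p => φ (g p)) p.1 p.2).symm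
  exact congr($this f)

end

variable {F ι Λ H A : Type*} [Field F] [Ring H] [Algebra F H]
  [NonUnitalRing A] [Module F A] [IsScalarTower F A A] [SMulCommClass F A A]

theorem eval_var (γ : Module.Basis Λ F H) (ρ : H →ₐ[F] Module.End F A) (y : ι → A) (i : ι) (h : H) :
    eval γ ρ y (var γ i h) = ρ h (y i) := by
  conv_rhs => rw [← γ.linearCombination_repr h]
  rw [var, eval, Finsupp.linearCombination_apply, map_finsuppSum, map_finsuppSum, Finsupp.sum,
    Finsupp.sum, LinearMap.sum_apply]
  refine Finset.sum_congr rfl fun β _ => ?_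
  rw [map_smul, lift_gen, map_smul, LinearMap.smul_apply]

theorem rename_var (γ : Module.Basis Λ F H) (σ : ι → ι) (i : ι) (h : H) :
    rename σ (var γ i h) = var γ (σ i) h := by
  rw [var, var, map_finsuppSum]
  refine Finsupp.sum_congr fun β _ => ?_
  rw [map_smul, rename, lift_gen]

theorem rename_rename (σ τ : ι → ι) (f : HPoly F ι Λ) :
    rename τ (rename σ f) = rename (τ ∘ σ) f := by
  rw [rename, rename, map_lift]
  simp_rw [lift_gen]
  rfl

theorem eval_rename (γ : Module.Basis Λ F H) (ρ : H →ₐ[F] Module.End F A) (y : ι → A) (σ : ι → ι)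
    (f : HPoly F ι Λ) : eval γ ρ y (rename σ f) = eval γ ρ (fun i => y (σ i)) f := by
  rw [rename, eval, map_lift]
  simp_rw [lift_gen]
  rfl

theorem rename_mem_multilinear {γ : Module.Basis Λ F H} (σ : Equiv.Perm ι) {f : HPoly F ι Λ}
    (hf : f ∈ multilinear ι γ) : rename σ f ∈ multilinear ι γ := by
  induction hf using Submodule.span_induction with
  | mem f hf =>
    obtain ⟨n, e, h, rfl⟩ := hf
    refine Submodule.subset_span ⟨n, e.trans σ, h, ?_⟩
    simp [map_seqProd, rename_var]
  | zero => rw [map_zero]; exact Submodule.zero_mem _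
  | add _ _ _ _ h₁ h₂ => rw [map_add]; exact Submodule.add_mem _ h₁ h₂
  | smul r _ _ h => rw [map_smul]; exact Submodule.smul_mem _ r h

end HPoly

/-! ### From functions to formal multilinear polynomials -/

section Words

variable {F H B X : Type*} [Field F] [Ring H] [Algebra F H] [NonUnitalRing B]
    [Module F B] (ρ : H →ₐ[F] Module.End F B)

/-- The value of a word in the symbols `v^h`, where `v` is a variable or a constant. -/
def wordValue (w : FreeSemigroup ((X ⊕ B) × H)) (x : X → B) : B :=
  FreeSemigroup.lift (fun p => ρ p.2 (Sum.elim x id p.1)) w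

/-- The variables and constants of a word, with multiplicities. -/
def wordDegree {H B X : Type*} (w : FreeSemigroup ((X ⊕ B) × H)) : Multiset (X ⊕ B) :=
  w.head.1 ::ₘ (w.tail.map Prod.fst : List (X ⊕ B))

theorem wordDegree_mul {H B X : Type*} (w₁ w₂ : FreeSemigroup ((X ⊕ B) × H)) :
    wordDegree (w₁ * w₂) = wordDegree w₁ + wordDegree w₂ := by
  rw [wordDegree, wordDegree, wordDegree, FreeSemigroup.tail_mul, FreeSemigroup.head_mul,
    List.map_append, ← Multiset.coe_add, List.map_cons, ← Multiset.cons_coe, Multiset.cons_add]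

theorem wordValue_mul (w₁ w₂ : FreeSemigroup ((X ⊕ B) × H)) (x : X → B) :
    wordValue ρ (w₁ * w₂) x = wordValue ρ w₁ x * wordValue ρ w₂ x := map_mul _ _ _

/-- The functions given by linear combinations of words of given degree. -/
def wordSpan (M : Multiset (X ⊕ B)) : Submodule F ((X → B) → B) :=
  Submodule.span F {Φ | ∃ w, wordDegree w = M ∧ Φ = wordValue ρ w}

variable {ρ}

variable [IsScalarTower F B B] [SMulCommClass F B B] {M : Multiset (X ⊕ B)} {Φ : (X → B) → B}

theorem mul_mem_wordSpan {M₁ M₂ : Multiset (X ⊕ B)} {Φ₁ Φ₂ : (X → B) → B}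
    (h₁ : Φ₁ ∈ wordSpan ρ M₁) (h₂ : Φ₂ ∈ wordSpan ρ M₂) :
    Φ₁ * Φ₂ ∈ wordSpan ρ (M₁ + M₂) := by
  have h := Submodule.apply_mem_map₂ (LinearMap.mul F ((X → B) → B)) h₁ h₂
  rw [wordSpan, wordSpan, Submodule.map₂_span_span] at h
  refine Submodule.span_mono ?_ h
  rintro _ ⟨_, ⟨w₁, rfl, rfl⟩, _, ⟨w₂, rfl, rfl⟩, rfl⟩
  exact ⟨w₁ * w₂, wordDegree_mul _ _, funext fun x => (wordValue_mul ρ w₁ w₂ x).symm⟩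

/-- Induction on words by the rule for `h(ab)`. Its second kind of terms reverses the factors, which
is harmless since the degree ignores order. -/
theorem act_mem_wordSpan (hρ : IsGeneralizedAction ρ) (h : H) (hΦ : Φ ∈ wordSpan ρ M) :
    (fun x => ρ h (Φ x)) ∈ wordSpan ρ M := by
  have key : ∀ (w : FreeSemigroup ((X ⊕ B) × H)) (h : H),
      (fun x => ρ h (wordValue ρ w x)) ∈ wordSpan ρ (wordDegree w) := by
    intro w
    induction w using FreeSemigroup.recOnMul with
    | ih1 p =>
      refine fun h => Submodule.subset_span ⟨FreeSemigroup.of (p.1, h * p.2), rfl, funext fun x => ?_⟩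
      simp [wordValue]
    | ih2 p w ih₁ ih₂ =>
      intro h
      obtain ⟨k, h₁, h₂, h₃, h₄, hh⟩ := hρ h
      have : (fun x => ρ h (wordValue ρ (FreeSemigroup.of p * w) x)) = ∑ i,
          ((fun x => ρ (h₁ i) (wordValue ρ (FreeSemigroup.of p) x)) *
            (fun x => ρ (h₂ i) (wordValue ρ w x)) +
          (fun x => ρ (h₃ i) (wordValue ρ w x)) *
            (fun x => ρ (h₄ i) (wordValue ρ (FreeSemigroup.of p) x))) := by
        funext x
        rw [wordValue_mul, hh, Finset.sum_apply]
        rfl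
      rw [this, wordDegree_mul]
      exact Submodule.sum_mem _ fun i _ => Submodule.add_mem _ (mul_mem_wordSpan (ih₁ _) (ih₂ _))
        (add_comm (wordDegree w) _ ▸ mul_mem_wordSpan (ih₂ _) (ih₁ _))
  induction hΦ using Submodule.span_induction with
  | mem Φ hΦ =>
    obtain ⟨w, rfl, rfl⟩ := hΦ
    exact key w h
  | zero =>
    simp only [Pi.zero_apply, map_zero]
    exact Submodule.zero_mem (wordSpan ρ M)
  | add _ _ _ _ h₁ h₂ => simpa [map_add] using! Submodule.add_mem _ h₁ h₂
  | smul r _ _ h => simpa [map_smul] using! Submodule.smul_mem _ r h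

theorem MultihomPoly.mem_wordSpan (hρ : IsGeneralizedAction ρ) {m : Multiset X} {c : Multiset B}
    (h : MultihomPoly ρ m c Φ) : Φ ∈ wordSpan ρ (m.map Sum.inl + c.map Sum.inr) := by
  induction h with
  | var v =>
    refine Submodule.subset_span ⟨FreeSemigroup.of (Sum.inl v, 1), by simp [wordDegree], ?_⟩
    simp [wordValue, funext_iff]
  | const b =>
    refine Submodule.subset_span ⟨FreeSemigroup.of (Sum.inr b, 1), by simp [wordDegree], ?_⟩
    simp [wordValue, funext_iff]
  | mul _ _ ih₁ ih₂ =>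
    have := mul_mem_wordSpan ih₁ ih₂
    rwa [add_add_add_comm, ← Multiset.map_add, ← Multiset.map_add] at this
  | act h _ ih => exact act_mem_wordSpan hρ h ih
  | add _ _ ih₁ ih₂ => exact Submodule.add_mem _ ih₁ ih₂
  | smul r _ ih => exact Submodule.smul_mem _ r ih

/-- Each occurrence of a constant becomes a variable of its own, so a word becomes a monomial that
contains every variable once. -/
theorem exists_multilinear_of_mem_wordSpan {Λ ι : Type*} [Fintype ι] (γ : Module.Basis Λ F H)
    (g : ι → X ⊕ B) (hg : Finset.univ.val.map g = M) (hΦ : Φ ∈ wordSpan ρ M) :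
    ∃ f ∈ HPoly.multilinear ι γ, ∀ x, HPoly.eval γ ρ (fun i => Sum.elim x id (g i)) f = Φ x := by
  induction hΦ using Submodule.span_induction with
  | mem Φ hΦ =>
    obtain ⟨⟨p, l⟩, hw, rfl⟩ := hΦ
    have hu : Finset.univ.val.map (fun i => ((p :: l).get i).1) = Finset.univ.val.map g := by
      rw [hg, ← hw, Fin.univ_val_map, ← Function.comp_def Prod.fst, ← List.map_ofFn, List.ofFn_get]
      rfl
    obtain ⟨e, he⟩ := Multiset.exists_equiv_of_map_univ_eq hu
    refine ⟨_, Submodule.subset_span ⟨l.length, e, fun i => ((p :: l).get i).2, rfl⟩, fun x => ?_⟩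
    rw [map_seqProd, wordValue, FreeSemigroup.lift_eq_seqProd]
    congr 1
    funext i
    rw [HPoly.eval_var, he]
  | zero => exact ⟨0, Submodule.zero_mem _, fun x => map_zero _⟩
  | add _ _ _ _ h₁ h₂ =>
    obtain ⟨f₁, hf₁, h₁⟩ := h₁
    obtain ⟨f₂, hf₂, h₂⟩ := h₂
    exact ⟨f₁ + f₂, Submodule.add_mem _ hf₁ hf₂, fun x => by rw [map_add, h₁, h₂]; rfl⟩
  | smul r _ _ h =>
    obtain ⟨f, hf, h⟩ := h
    exact ⟨r • f, Submodule.smul_mem _ r hf, fun x => by rw [map_smul, h]; rfl⟩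

end Words

/-! ### Permutations within blocks -/

section BlockAlternation

variable {ι κ J : Type*} [DecidableEq κ] [DecidableEq J]

/-- The permutation of the variables that permutes each block by the given permutation. -/
def blockPerm (σ : κ → Equiv.Perm J) : Equiv.Perm ((κ × J) ⊕ ι) :=
  Equiv.sumCongr (Equiv.prodShear (Equiv.refl κ) σ) (Equiv.refl ι)

theorem swap_mul_blockPerm [DecidableEq ι] (σ : κ → Equiv.Perm J) (m : κ) (i j : J) :
    (Equiv.swap (Sum.inl (m, i)) (Sum.inl (m, j)) : Equiv.Perm ((κ × J) ⊕ ι)) * blockPerm σ =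
      blockPerm (Pi.mulSingle m (Equiv.swap i j) * σ) := by
  ext (⟨m', j'⟩ | t)
  · by_cases hm : m' = m
    · subst hm
      simp only [blockPerm, Equiv.Perm.mul_apply, Equiv.sumCongr_apply, Sum.map_inl,
        Equiv.prodShear_apply, Equiv.refl_apply, Pi.mul_apply, Pi.mulSingle_eq_same,
        Equiv.swap_apply_def]
      grind
    · simp [blockPerm, Equiv.swap_apply_of_ne_of_ne, hm]
  · simp [blockPerm, Equiv.swap_apply_of_ne_of_ne]

/-- The product of the signs of a family of permutations. -/
def blockSign [Fintype κ] [Fintype J] (σ : κ → Equiv.Perm J) : ℤˣ := ∏ m, Equiv.Perm.sign (σ m)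

theorem blockSign_mulSingle_swap_mul [Fintype κ] [Fintype J] (σ : κ → Equiv.Perm J) (m : κ)
    {i j : J} (hij : i ≠ j) :
    blockSign (Pi.mulSingle m (Equiv.swap i j) * σ) = -blockSign σ := by
  have : ∏ k, Equiv.Perm.sign ((Pi.mulSingle m (Equiv.swap i j) : κ → Equiv.Perm J) k) = -1 := by
    rw [Finset.prod_eq_single m (fun k _ hk => by rw [Pi.mulSingle_eq_of_ne hk, map_one])
      (fun h => absurd (Finset.mem_univ m) h), Pi.mulSingle_eq_same, Equiv.Perm.sign_swap hij]
  simp only [blockSign, Pi.mul_apply, map_mul, Finset.prod_mul_distrib, this, neg_one_mul]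

end BlockAlternation

/-! ### Any even number of blocks with fixed constants -/

namespace MultihomPoly

variable {F H B : Type*} [Field F] [IsAlgClosed F] [CharZero F] [Ring H] [Algebra F H]
  [NonUnitalRing B] [Module F B] [IsScalarTower F B B] [SMulCommClass F B B]
  [FiniteDimensional F B] {ρ : H →ₐ[F] Module.End F B} {n : ℕ}

/-- For an `H`-simple algebra there are constants such that, for any `k ≥ 1`, the product of the
determinants of `2 * k` blocks of variables and a further variable is the value of an
`H`-polynomial with these constants. -/
theorem exists_prod_det_smul (hρ : IsHSimple ρ) (hss : IsSemisimpleAlg B)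
    (a : Module.Basis (Fin n) F B) :
    ∃ c : Multiset B, ∀ k : ℕ, 0 < k → MultihomPoly ρ (X := (ℕ × Fin n) ⊕ Unit)
      (∑ j ∈ Finset.range (2 * k), Finset.univ.val.map (fun i => Sum.inl (j, i)) + {Sum.inr ()}) c
      fun x => (∏ j ∈ Finset.range (2 * k), a.det fun i => x (Sum.inl (j, i))) • x (Sum.inr ()) := by
  classical
  have := hρ.1
  have : Nonempty (Fin n) := a.index_nonempty
  let b : ℕ → Fin n → (ℕ × Fin n) ⊕ Unit := fun j i => Sum.inl (j, i)
  have hb : ∀ j, Function.Injective (b j) := fun j i i' h => by simpa [b] using h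
  have hz : ∀ j, Sum.inr () ∉ Set.range (b j) := fun j => by simp [b]
  obtain ⟨c₀, h₀⟩ := exists_det_smul hρ hss a (hb 0) (hz 0)
  obtain ⟨c₁, h₁⟩ := exists_det_smul hρ hss a (hb 1) (hz 1)
  -- Block `0` is kept apart to carry the trace trick. The `2 * (k + 1)` blocks start with two that
  -- need constants; all later pairs need none.
  have key : ∀ k : ℕ, MultihomPoly ρ (Finset.univ.val.map (b 0) +
      (∑ j ∈ Finset.Ico 1 (2 * (k + 1)), Finset.univ.val.map (b j) + {Sum.inr ()})) (c₀ + c₁)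
      fun x => a.det (fun i => x (b 0 i)) •
        (∏ j ∈ Finset.Ico 1 (2 * (k + 1)), a.det fun i => x (b j i)) • x (Sum.inr ()) := by
    intro k
    induction k with
    | zero =>
      -- The second block enters by substituting its determinant times `z` for `z` in the function
      -- of the first.
      have hG : ∀ v, MultihomPoly ρ
          (if v = Sum.inr () then Finset.univ.val.map (b 1) + {Sum.inr ()} else {v})
          (if v = Sum.inr () then c₁ else 0)
          fun x => if v = Sum.inr () then a.det (fun i => x (b 1 i)) • x (Sum.inr ()) else x v :=
        fun v => by
          by_cases hv : v = Sum.inr ()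
          · simpa [hv] using h₁
          · simpa [hv] using var v
      have hcount : (Finset.univ.val.map (b 0)).count (Sum.inr ()) = 0 :=
        Multiset.count_eq_zero_of_notMem fun hi => hz 0 (by simp at hi)
      refine (h₀.subst hG).of_eq ?_ ?_ fun x => ?_
      · rw [Multiset.add_bind, Multiset.singleton_bind, if_pos rfl, Multiset.bind_map]
        simp [b, Multiset.bind_singleton]
      · rw [Multiset.bind_ite_eq_count_nsmul, Multiset.count_add, hcount]
        simp
      · simp [b]
    | succ k ih =>
      have hne : ∀ j, j ≠ 0 → ∀ i, b j i ∉ Set.range (b 0) := by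
        rintro j hj i ⟨i', h⟩
        simp only [b, Sum.inl.injEq, Prod.mk.injEq] at h
        exact hj h.1.symm
      refine (ih.det_smul_det_smul (p := b (2 * (k + 1))) (q := b (2 * (k + 1) + 1)) hss (hb 0)
        (fun i hi => ?_) (fun x y hxy => ?_) (hne _ (by omega)) (hne _ (by omega))).of_eq ?_ rfl
        fun x => ?_
      · simp only [Multiset.mem_add, Multiset.mem_sum, Multiset.mem_map, Multiset.mem_singleton,
          Finset.mem_Ico] at hi
        rcases hi with ⟨j, hj, i', -, h⟩ | h
        · exact hne j (by omega) i' ⟨i, h.symm⟩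
        · exact hz 0 ⟨i, h⟩
      · rw [hxy _ (hz 0), Finset.prod_congr rfl fun j hj => by
          rw [funext fun i => hxy _ (hne j (by rw [Finset.mem_Ico] at hj; omega) i)]]
      · rw [mul_add 2 (k + 1), mul_one, Finset.sum_Ico_succ_top (by omega),
          Finset.sum_Ico_succ_top (by omega)]
        abel
      · rw [mul_add 2 (k + 1), mul_one, Finset.prod_Ico_succ_top (by omega),
          Finset.prod_Ico_succ_top (by omega), smul_comm, smul_smul (_ * _)]
        congr 2
        ring
  refine ⟨c₀ + c₁, fun k hk => ?_⟩
  obtain ⟨k, rfl⟩ := Nat.exists_eq_add_of_lt hk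
  rw [zero_add]
  refine (key k).of_eq ?_ rfl fun x => ?_
  · rw [Finset.range_eq_Ico, ← add_assoc]
    congr 1
  · rw [Finset.range_eq_Ico, smul_smul]
    congr 1

end MultihomPoly

/-! ### Signed averaging and the main theorem -/

/-- The average over all block permutations, with signs, of the renamings of `f`. -/
noncomputable def HPoly.blockAlternation {F Λ ι κ J : Type*} [Field F] [Fintype κ]
    [DecidableEq κ] [Fintype J] [DecidableEq J] (f : HPoly F ((κ × J) ⊕ ι) Λ) :
    HPoly F ((κ × J) ⊕ ι) Λ :=
  (Fintype.card (κ → Equiv.Perm J) : F)⁻¹ •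
    ∑ σ : κ → Equiv.Perm J, ((blockSign σ : ℤ) : F) • HPoly.rename (blockPerm σ) f

/-- A swap inside a block reindexes the sum by left multiplication and reverses every sign. -/
theorem HPoly.isAlternatingIn_blockAlternation {F Λ ι κ J : Type*} [Field F] [Fintype κ]
    [DecidableEq κ] [Fintype J] [DecidableEq J] [DecidableEq ι] (f : HPoly F ((κ × J) ⊕ ι) Λ)
    (m : κ) : IsAlternatingIn (blockAlternation f) (Set.range fun j => Sum.inl (m, j)) := by
  rintro _ ⟨i, rfl⟩ _ ⟨j, rfl⟩ hij
  have hij' : i ≠ j := fun h => hij (by rw [h])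
  rw [blockAlternation, map_smul, map_sum, ← smul_neg, ← Finset.sum_neg_distrib]
  congr 1
  refine Fintype.sum_equiv (Equiv.mulLeft (Pi.mulSingle m (Equiv.swap i j))) _ _ fun σ => ?_
  rw [Equiv.coe_mulLeft, map_smul, rename_rename, ← Equiv.Perm.coe_mul, swap_mul_blockPerm,
    blockSign_mulSingle_swap_mul σ m hij', ← neg_smul]
  simp

/-- The variables are indexed by `(Fin (2 * k) × Fin ℓ) ⊕ (Fin T ⊕ Unit)`: the index `inl (m, j)`
stands for the `j`-th variable of the `m`-th set, `inr (inl j)` for `z_j` and `inr (inr ())` for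
`z`. -/
theorem mainTheorem7 {F H B Λ : Type*} [Field F] [IsAlgClosed F] [CharZero F]
    [Ring H] [Algebra F H] [FiniteDimensional F H]
    [NonUnitalRing B] [Module F B] [IsScalarTower F B B] [SMulCommClass F B B]
    (γ : Module.Basis Λ F H)
    (ρ : H →ₐ[F] Module.End F B) (hρ : IsGeneralizedAction ρ)
    (hsimple : IsHSimple ρ) (hss : IsSemisimpleAlg B)
    {ℓ : ℕ} (a : Module.Basis (Fin ℓ) F B) :
    ∃ (T : ℕ) (zbar : Fin T → B), ∀ k : ℕ, 0 < k →
      ∃ f : HPoly F ((Fin (2 * k) × Fin ℓ) ⊕ (Fin T ⊕ Unit)) Λ,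
        f ∈ HPoly.multilinear ((Fin (2 * k) × Fin ℓ) ⊕ (Fin T ⊕ Unit)) γ ∧
        (∀ m : Fin (2 * k), HPoly.IsAlternatingIn f (Set.range fun j => Sum.inl (m, j))) ∧
        ∀ z : B,
          HPoly.eval γ ρ (Sum.elim (fun p => a p.2) (Sum.elim zbar fun _ => z)) f = z := by
  have : FiniteDimensional F B := a.finiteDimensional_of_finite
  obtain ⟨c, hc⟩ := MultihomPoly.exists_prod_det_smul hsimple hss a
  -- `T` counts the constants with multiplicity; they are fixed before `k`.
  refine ⟨c.toList.length, c.toList.get, fun k hk => ?_⟩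
  let g : (Fin (2 * k) × Fin ℓ) ⊕ (Fin c.toList.length ⊕ Unit) → ((ℕ × Fin ℓ) ⊕ Unit) ⊕ B :=
    Sum.elim (fun p => Sum.inl (Sum.inl (p.1, p.2)))
      (Sum.elim (fun t => Sum.inr (c.toList.get t)) fun _ => Sum.inl (Sum.inr ()))
  have hg : Finset.univ.val.map g =
      (∑ j ∈ Finset.range (2 * k), Finset.univ.val.map (fun i : Fin ℓ => Sum.inl (j, i)) +
        {Sum.inr ()}).map Sum.inl + c.map Sum.inr := by
    have h1 : c.map (Sum.inr : B → ((ℕ × Fin ℓ) ⊕ Unit) ⊕ B) =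
        ∑ t, {Sum.inr (c.toList.get t)} := by
      conv_lhs => rw [← c.coe_toList, ← List.ofFn_get c.toList, ← Fin.univ_val_map, Multiset.map_map,
        Multiset.map_univ_eq_sum]
      rfl
    rw [Multiset.map_univ_eq_sum, h1, Finset.sum_range, Fintype.sum_sum_type,
      Fintype.sum_sum_type, Fintype.sum_prod_type, Multiset.map_add, ← Multiset.coe_mapAddMonoidHom,
      map_sum]
    simp_rw [Multiset.coe_mapAddMonoidHom, Multiset.map_map]
    simp_rw [Multiset.map_univ_eq_sum]
    simp [g, add_comm]
  obtain ⟨f, hf, hfe⟩ := exists_multilinear_of_mem_wordSpan γ g hg ((hc k hk).mem_wordSpan hρ)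
  refine ⟨HPoly.blockAlternation f, Submodule.smul_mem _ _ (Submodule.sum_mem _ fun σ _ =>
    Submodule.smul_mem _ _ (HPoly.rename_mem_multilinear _ hf)),
    HPoly.isAlternatingIn_blockAlternation f, fun z => ?_⟩
  -- Only the values of `f` are known, not its form. Renaming by `σ` evaluates the block
  -- determinants at permuted bases, which yields the product of the signs; these cancel the signs
  -- in the average.
  have hval : ∀ σ : Fin (2 * k) → Equiv.Perm (Fin ℓ),
      HPoly.eval γ ρ (Sum.elim (fun p => a p.2) (Sum.elim c.toList.get fun _ => z))
        (HPoly.rename (blockPerm σ) f) = ((blockSign σ : ℤ) : F) • z := fun σ => by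
    -- The value `0` fills the blocks with index at least `2 * k`, which do not occur.
    let x : (ℕ × Fin ℓ) ⊕ Unit → B := Sum.elim
      (fun p => if h : p.1 < 2 * k then a (σ ⟨p.1, h⟩ p.2) else 0) fun _ => z
    have hx := hfe x
    rw [HPoly.eval_rename]
    have h1 : (fun i => Sum.elim x id (g i)) = fun i =>
        (Sum.elim (fun p => a p.2) (Sum.elim c.toList.get fun _ => z) : _ → B) (blockPerm σ i) := by
      funext i
      rcases i with ⟨m, j⟩ | t | t <;> simp [x, g, blockPerm]
    rw [← h1, hx, Finset.prod_range]
    congr 1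
    rw [blockSign, Units.coe_prod, Int.cast_prod]
    refine Finset.prod_congr rfl fun m _ => ?_
    have h2 := a.det.map_perm a (σ m)
    rw [a.det_self, Units.smul_def, zsmul_one] at h2
    simpa [x, Function.comp_def] using h2
  rw [HPoly.blockAlternation, map_smul, map_sum]
  have hsign : ∀ σ : Fin (2 * k) → Equiv.Perm (Fin ℓ),
      ((blockSign σ : ℤ) : F) * ((blockSign σ : ℤ) : F) = 1 := fun σ => by
    rw [← Int.cast_mul, ← Units.val_mul, Int.units_mul_self, Units.val_one, Int.cast_one]
  simp_rw [map_smul, hval, smul_smul, hsign, one_smul]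
  rw [Finset.sum_const, Finset.card_univ, ← Nat.cast_smul_eq_nsmul F, smul_smul, inv_mul_cancel₀,
    one_smul]
  exact Nat.cast_ne_zero.2 Fintype.card_ne_zero
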